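/- Let $R$ be a nonzero commutative unital ring. Let $\mathscr{C}_R$ be the following category. Its objects are the couples $(G,X)$, written $X/G$, where $G$ is a finite group and $X$ is a finite $G$-set. The morphisms from $X/G$ to $Y/H$ are the elements of $RB^{H,G}(Y,X)=R\otimes_{\mathbb Z}B^{H,G}(Y,X)$, where $B^{H,G}(Y,X)$ is the Grothendieck group, with respect to disjoint union, of isomorphism classes of spans $Y\xleftarrow{\ \beta\ }U\xrightarrow{\ \alpha\ }X$ of finite $(H\times G)$-sets; here $H\times G$ acts on $Y$ through $H$ and on $X$ through $G$. Composition is the $R$-bilinear extension of $$\langle V,\delta,\gamma\rangle\circ\langle U,\beta,\alpha\rangle=\langle V\hat\times_H U,\hat\delta,\hat\alpha\rangle ,\qquad \hat\delta[v,u]=\delta(v),\quad \hat\alpha[v,u]=\alpha(u),$$ where $V$ is a $(K\times H)$-set, $U$ is an $(H\times G)$-set, and $V\hat\times_H U$ is the $(K\times G)$-set of $H$-orbits of $\{(v,u)\in V\times U:\gamma(v)=\beta(u)\}$ under $(v,u)\cdot h=((1,h^{-1})v,\,(h^{-1},1)u)$, with action $(k,g)[v,u]=[(k,1)v,(1,g)u]$.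 The identity of $X/G$ is the class of $G\times X$ with action $(a,b)(g,x)=(agb^{-1},ax)$ and legs $(g,x)\mapsto x$ (left) and $(g,x)\mapsto g^{-1}x$ (right). Theorem. Let $G$ and $H$ be finite groups, $X$ a finite $G$-set and $Y$ a finite $H$-set. Suppose that $X$ decomposes into $G$-orbits as $\bigsqcup_{i=1}^n O_i$, the stabilizer of an element of $O_i$ being $G_i$, and that $Y$ decomposes into $H$-orbits as $\bigsqcup_{j=1}^m T_j$, the stabilizer of an element of $T_j$ being $H_j$. If $X/G$ is isomorphic to $Y/H$ in $\mathscr{C}_R$, then $n=m$ and there exists $\sigma\in S_n$ such that $G_i\cong H_{\sigma(i)}$ as groups for every $i$. -/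

import Mathlib

open CategoryTheory
open scoped TensorProduct

universe v u

/-- A couple `(G, X)`, written as a fraction `X / G`: a finite group `G` and a finite `G`-set `X`. -/
structure GFrac : Type (u + 1) where
  /-- the finite group (the denominator) -/
  grp : Type u
  /-- the finite set on which the group acts (the numerator) -/
  pts : Type u
  [group : Group grp]
  [finite_grp : Finite grp]
  [action : MulAction grp pts]
  [finite_pts : Finite pts]

attribute [instance] GFrac.group GFrac.finite_grp GFrac.action GFrac.finite_pts

/-- A span `Y ← U → X` of finite `(H × G)`-sets, where `A = X / G` and `B = Y / H`, the set `X` being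
an `(H × G)`-set through the projection to `G` and `Y` through the projection to `H`. -/
structure GSpan (A B : GFrac.{u}) : Type (u + 1) where
  /-- the `(H × G)`-set `U` -/
  pts : Type u
  [finite_pts : Finite pts]
  [action : MulAction (B.grp × A.grp) pts]
  /-- the leg `U → Y` -/
  left : pts → B.pts
  /-- the leg `U → X` -/
  right : pts → A.pts
  left_smul : ∀ (h : B.grp) (g : A.grp) (p : pts), left ((h, g) • p) = h • left p
  right_smul : ∀ (h : B.grp) (g : A.grp) (p : pts), right ((h, g) • p) = g • right p

attribute [instance] GSpan.finite_pts GSpan.action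

namespace GSpan

variable {A B C D : GFrac.{u}}

/-- Two spans are isomorphic when there is an isomorphism of `(H × G)`-sets between them which
commutes with the maps to `Y` and `X`. -/
def Iso (U U' : GSpan A B) : Prop :=
  ∃ e : U.pts ≃ U'.pts, (∀ (a : B.grp × A.grp) (p : U.pts), e (a • p) = a • e p) ∧
    (∀ p, U'.left (e p) = U.left p) ∧ (∀ p, U'.right (e p) = U.right p)

theorem Iso.refl (U : GSpan A B) : Iso U U :=
  ⟨Equiv.refl _, fun _ _ => rfl, fun _ => rfl, fun _ => rfl⟩

theorem Iso.symm {U U' : GSpan A B} : Iso U U' → Iso U' U := by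
  rintro ⟨e, h1, h2, h3⟩
  refine ⟨e.symm, fun a p => ?_, fun p => ?_, fun p => ?_⟩
  · rw [Equiv.symm_apply_eq, h1, Equiv.apply_symm_apply]
  · rw [← h2, Equiv.apply_symm_apply]
  · rw [← h3, Equiv.apply_symm_apply]

theorem Iso.trans {U U' U'' : GSpan A B} : Iso U U' → Iso U' U'' → Iso U U'' := by
  rintro ⟨e, h1, h2, h3⟩ ⟨f, k1, k2, k3⟩
  exact ⟨e.trans f, fun a p => by simp [h1, k1], fun p => by simp [h2, k2],
    fun p => by simp [h3, k3]⟩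

/-- Isomorphism of spans, as a setoid. -/
instance setoid (A B : GFrac.{u}) : Setoid (GSpan A B) where
  r := Iso
  iseqv := ⟨Iso.refl, Iso.symm, Iso.trans⟩

/-- The empty span. -/
def empty (A B : GFrac.{u}) : GSpan A B where
  pts := PEmpty
  action :=
    { smul := fun _ p => p
      one_smul := fun _ => rfl
      mul_smul := fun _ _ _ => rfl }
  left := PEmpty.elim
  right := PEmpty.elim
  left_smul := fun _ _ p => p.elim
  right_smul := fun _ _ p => p.elim

/-- The disjoint union of two spans. -/
def sum (U U' : GSpan A B) : GSpan A B where
  pts := U.pts ⊕ U'.pts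
  left := Sum.elim U.left U'.left
  right := Sum.elim U.right U'.right
  left_smul := by
    rintro h g (p | p)
    · exact U.left_smul h g p
    · exact U'.left_smul h g p
  right_smul := by
    rintro h g (p | p)
    · exact U.right_smul h g p
    · exact U'.right_smul h g p

/-- The identity span of `X / G`: the set `G × X` with `(a, b) (g, x) = (a g b⁻¹, a x)`,
and with legs `(g, x) ↦ x` and `(g, x) ↦ g⁻¹ x`. -/
def id (A : GFrac.{u}) : GSpan A A where
  pts := A.grp × A.pts
  action :=
    { smul := fun a p => (a.1 * p.1 * a.2⁻¹, a.1 • p.2)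
      one_smul := fun p => Prod.ext
        (show (1 : A.grp) * p.1 * (1 : A.grp)⁻¹ = p.1 by simp) (one_smul _ p.2)
      mul_smul := fun a b p => Prod.ext
        (show a.1 * b.1 * p.1 * (a.2 * b.2)⁻¹ = a.1 * (b.1 * p.1 * b.2⁻¹) * a.2⁻¹ by group)
        (mul_smul a.1 b.1 p.2) }
  left := fun p => p.2
  right := fun p => p.1⁻¹ • p.2
  left_smul := fun _ _ _ => rfl
  right_smul := fun h g p =>
    show (h * p.1 * g⁻¹)⁻¹ • h • p.2 = g • p.1⁻¹ • p.2 by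
      simp only [smul_smul]; congr 1; group

/-- The pullback `W ⊆ V × U` of `γ : V → Y` and `β : U → Y`. -/
def Pull (V : GSpan B C) (U : GSpan A B) : Type u :=
  {p : V.pts × U.pts // V.right p.1 = U.left p.2}

/-- The orbit relation of the right action `(v, u) · h = (v · h, h⁻¹ · u)` of `H` on the pullback;
in terms of the left actions, `v · h = (1, h⁻¹) v` and `h⁻¹ · u = (h⁻¹, 1) u`. -/
def pullSetoid (V : GSpan B C) (U : GSpan A B) : Setoid (Pull V U) where
  r p q := ∃ h : B.grp, q.1 = (((1 : C.grp), h⁻¹) • p.1.1, (h⁻¹, (1 : A.grp)) • p.1.2)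
  iseqv :=
    { refl := fun p => ⟨1, by
        rw [inv_one]; exact Prod.ext (one_smul _ _).symm (one_smul _ _).symm⟩
      symm := by
        rintro p q ⟨h, hq⟩
        exact ⟨h⁻¹, by rw [hq]; simp [smul_smul, ← Prod.one_eq_mk]⟩
      trans := by
        rintro p q r ⟨h, hq⟩ ⟨k, hr⟩
        exact ⟨h * k, by rw [hr, hq]; simp [smul_smul]⟩ }

/-- The set `V ×̂_H U` of `H`-orbits of the pullback. -/
def CompPts (V : GSpan B C) (U : GSpan A B) : Type u := Quotient (pullSetoid V U)

instance (V : GSpan B C) (U : GSpan A B) : Finite (CompPts V U) := by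
  have : Finite (Pull V U) := Subtype.finite
  exact Quotient.finite _

/-- The class `[v, u]` in `V ×̂_H U`. -/
def CompPts.mk {V : GSpan B C} {U : GSpan A B} (p : V.pts) (q : U.pts)
    (h : V.right p = U.left q) : CompPts V U :=
  Quotient.mk (pullSetoid V U) ⟨(p, q), h⟩

theorem CompPts.ind {V : GSpan B C} {U : GSpan A B} {P : CompPts V U → Prop}
    (h : ∀ p q hpq, P (CompPts.mk p q hpq)) (x : CompPts V U) : P x :=
  Quotient.inductionOn x fun p => h p.1.1 p.1.2 p.2

theorem CompPts.mk_eq_iff {V : GSpan B C} {U : GSpan A B} {p p' : V.pts} {q q' : U.pts}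
    {h : V.right p = U.left q} {h' : V.right p' = U.left q'} :
    CompPts.mk p q h = CompPts.mk p' q' h' ↔
      ∃ b : B.grp, p' = ((1 : C.grp), b) • p ∧ q' = (b, (1 : A.grp)) • q := by
  refine Quotient.eq.trans ⟨?_, ?_⟩
  · rintro ⟨b, hb⟩
    exact ⟨b⁻¹, congrArg Prod.fst hb, congrArg Prod.snd hb⟩
  · rintro ⟨b, hp, hq⟩
    exact ⟨b⁻¹, by simp [hp, hq]⟩

/-- A function on `V ×̂_H U` given by a function of `(v, u)` that is constant on `H`-orbits. -/
def CompPts.lift {V : GSpan B C} {U : GSpan A B} {T : Type*}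
    (f : ∀ (p : V.pts) (q : U.pts), V.right p = U.left q → T)
    (hf : ∀ (p : V.pts) (q : U.pts) h (b : B.grp) h',
      f (((1 : C.grp), b) • p) ((b, (1 : A.grp)) • q) h' = f p q h)
    (x : CompPts V U) : T :=
  Quotient.lift (s := pullSetoid V U) (fun p => f p.1.1 p.1.2 p.2) (by
    rintro ⟨⟨p, q⟩, h⟩ ⟨⟨p', q'⟩, h'⟩ ⟨b, hb⟩
    obtain ⟨rfl, rfl⟩ := Prod.mk.inj hb
    exact (hf p q h _ h').symm) x

theorem right_one_smul (V : GSpan B C) (c : C.grp) (p : V.pts) :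
    V.right ((c, (1 : B.grp)) • p) = V.right p := by rw [V.right_smul, one_smul]

theorem left_one_smul (U : GSpan A B) (a : A.grp) (q : U.pts) :
    U.left (((1 : B.grp), a) • q) = U.left q := by rw [U.left_smul, one_smul]

/-- The action `(k, g) [v, u] = [(k, 1) v, (1, g) u]` of `K × G` on `V ×̂_H U`. -/
instance (V : GSpan B C) (U : GSpan A B) : MulAction (C.grp × A.grp) (CompPts V U) where
  smul a := CompPts.lift
    (fun p q h => CompPts.mk ((a.1, (1 : B.grp)) • p) (((1 : B.grp), a.2) • q)
      (by rw [right_one_smul, left_one_smul, h]))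
    (fun p q h b h' => by
      refine Eq.symm (CompPts.mk_eq_iff.2 ⟨b, ?_, ?_⟩) <;> simp [smul_smul])
  one_smul := CompPts.ind fun p q h => CompPts.mk_eq_iff.2 ⟨1, by
    simp [← Prod.one_eq_mk], by simp [← Prod.one_eq_mk]⟩
  mul_smul a b := CompPts.ind fun p q h => CompPts.mk_eq_iff.2 ⟨1, by
    simp [smul_smul], by simp [smul_smul]⟩

theorem CompPts.smul_mk {V : GSpan B C} {U : GSpan A B} (a : C.grp × A.grp) (p : V.pts)
    (q : U.pts) (h : V.right p = U.left q) :
    a • CompPts.mk p q h = CompPts.mk ((a.1, (1 : B.grp)) • p) (((1 : B.grp), a.2) • q)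
      (by rw [right_one_smul, left_one_smul, h]) := rfl

/-- The composite span `⟨V, δ, γ⟩ ∘ ⟨U, β, α⟩ = ⟨V ×̂_H U, [v, u] ↦ δ v, [v, u] ↦ α u⟩`. -/
def comp (V : GSpan B C) (U : GSpan A B) : GSpan A C where
  pts := CompPts V U
  left := CompPts.lift (fun p _ _ => V.left p) (fun p _ _ b _ => by
    rw [V.left_smul, one_smul])
  right := CompPts.lift (fun _ q _ => U.right q) (fun _ q _ b _ => by
    rw [U.right_smul, one_smul])
  left_smul := fun k g => CompPts.ind fun p _ _ => V.left_smul k 1 p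
  right_smul := fun k g => CompPts.ind fun _ q _ => U.right_smul 1 g q

/-- To give an isomorphism of spans out of a composite. -/
theorem comp_iso_of {V : GSpan B C} {U : GSpan A B} {T : GSpan A C}
    (f : ∀ (p : V.pts) (q : U.pts), V.right p = U.left q → T.pts)
    (hf : ∀ (p : V.pts) (q : U.pts) h (b : B.grp) h',
      f (((1 : C.grp), b) • p) ((b, (1 : A.grp)) • q) h' = f p q h)
    (hs : ∀ (c : C.grp) (a : A.grp) (p : V.pts) (q : U.pts) h h',
      f ((c, (1 : B.grp)) • p) (((1 : B.grp), a) • q) h' = (c, a) • f p q h)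
    (hl : ∀ p q h, T.left (f p q h) = V.left p)
    (hr : ∀ p q h, T.right (f p q h) = U.right q)
    (hi : ∀ p q h p' q' h', f p q h = f p' q' h' →
      ∃ b : B.grp, p' = ((1 : C.grp), b) • p ∧ q' = (b, (1 : A.grp)) • q)
    (hsurj : ∀ t, ∃ p q h, f p q h = t) : Iso (comp V U) T := by
  refine ⟨Equiv.ofBijective (CompPts.lift f hf) ⟨?_, ?_⟩, ?_, ?_, ?_⟩
  · intro x y
    induction x using CompPts.ind with | h p q h => ?_
    induction y using CompPts.ind with | h p' q' h' => ?_
    intro e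
    exact CompPts.mk_eq_iff.2 (hi p q h p' q' h' e)
  · intro t
    obtain ⟨p, q, h, e⟩ := hsurj t
    exact ⟨CompPts.mk p q h, e⟩
  · exact fun a => CompPts.ind fun p q h => hs a.1 a.2 p q h _
  · exact CompPts.ind fun p q h => hl p q h
  · exact CompPts.ind fun p q h => hr p q h

/-- To give an isomorphism of spans by a correspondence. -/
theorem iso_of_corr {T T' : GSpan A B} {S : Type*} (f : S → T.pts) (f' : S → T'.pts)
    (hf : Function.Surjective f) (hf' : Function.Surjective f')
    (hff' : ∀ s t, f s = f t ↔ f' s = f' t)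
    (hs : ∀ (a : B.grp × A.grp) (s : S), ∃ t, f t = a • f s ∧ f' t = a • f' s)
    (hl : ∀ s, T.left (f s) = T'.left (f' s)) (hr : ∀ s, T.right (f s) = T'.right (f' s)) :
    Iso T T' := by
  have key : ∀ s, f' (Function.surjInv hf (f s)) = f' s := fun s =>
    (hff' _ _).1 (Function.surjInv_eq hf (f s))
  refine ⟨Equiv.ofBijective (fun p => f' (Function.surjInv hf p)) ⟨?_, ?_⟩, ?_, ?_, ?_⟩
  · intro p q e
    obtain ⟨s, rfl⟩ := hf p
    obtain ⟨t, rfl⟩ := hf q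
    simp only [key] at e
    exact (hff' _ _).2 e
  · intro p
    obtain ⟨s, rfl⟩ := hf' p
    exact ⟨f s, key s⟩
  · intro a p
    obtain ⟨s, rfl⟩ := hf p
    obtain ⟨t, h1, h2⟩ := hs a s
    change f' (Function.surjInv hf (a • f s)) = a • f' (Function.surjInv hf (f s))
    rw [← h1, key, key, h2]
  · intro p
    obtain ⟨s, rfl⟩ := hf p
    exact (congrArg T'.left (key s)).trans (hl s).symm
  · intro p
    obtain ⟨s, rfl⟩ := hf p
    exact (congrArg T'.right (key s)).trans (hr s).symm

theorem comp_congr {V V' : GSpan B C} {U U' : GSpan A B} :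
    Iso V V' → Iso U U' → Iso (comp V U) (comp V' U') := by
  rintro ⟨e, h1, h2, h3⟩ ⟨f, k1, k2, k3⟩
  refine comp_iso_of (T := comp V' U')
    (fun p q h => CompPts.mk (e p) (f q) (by rw [h3, k2, h])) ?_ ?_ ?_ ?_ ?_ ?_
  · intro p q h b h'
    exact (CompPts.mk_eq_iff.2 ⟨b, h1 _ _, k1 _ _⟩).symm
  · intro c a p q h h'
    exact CompPts.mk_eq_iff.2 ⟨1, by simp [h1, smul_smul], by simp [k1, smul_smul]⟩
  · exact fun p _ _ => h2 p
  · exact fun _ q _ => k3 q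
  · intro p q h p' q' h' E
    obtain ⟨b, hb, hb'⟩ := CompPts.mk_eq_iff.1 E
    exact ⟨b, e.injective (hb.trans (h1 _ _).symm), f.injective (hb'.trans (k1 _ _).symm)⟩
  · refine CompPts.ind fun p q h => ⟨e.symm p, f.symm q, ?_, ?_⟩
    · rw [← h3, ← k2, Equiv.apply_symm_apply, Equiv.apply_symm_apply, h]
    · exact CompPts.mk_eq_iff.2 ⟨1, by simp [← Prod.one_eq_mk], by simp [← Prod.one_eq_mk]⟩

theorem id_comp (U : GSpan A B) : Iso (comp (id B) U) U := by
  refine comp_iso_of (fun p q _ => (p.1, (1 : A.grp)) • q) ?_ ?_ ?_ ?_ ?_ ?_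
  · intro p q h b h'
    change ((1 * p.1 * b⁻¹, (1 : A.grp)) • (b, (1 : A.grp)) • q) = _
    simp [smul_smul]
  · intro c a p q h h'
    change ((c * p.1 * 1⁻¹, (1 : A.grp)) • ((1 : B.grp), a) • q) = _
    simp [smul_smul]
  · intro p q h
    have h : p.1⁻¹ • p.2 = U.left q := h
    rw [U.left_smul, ← h, smul_inv_smul]; rfl
  · intro p q h
    rw [U.right_smul, one_smul]
  · rintro ⟨g, y⟩ q h ⟨g', y'⟩ q' h' E
    have h : g⁻¹ • y = U.left q := h
    have h' : g'⁻¹ • y' = U.left q' := h'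
    have E : (g, (1 : A.grp)) • q = (g', (1 : A.grp)) • q' := E
    have E' : g • U.left q = g' • U.left q' := by
      have := congrArg U.left E
      rwa [U.left_smul, U.left_smul] at this
    refine ⟨g'⁻¹ * g, Prod.ext (show g' = 1 * g * (g'⁻¹ * g)⁻¹ by group)
      (show y' = (1 : B.grp) • y from ?_), ?_⟩
    · rw [one_smul, ← smul_inv_smul g' y', h', ← E', ← h, smul_inv_smul]
    · rw [← inv_smul_eq_iff.2 E]
      simp [smul_smul]
  · intro t
    refine ⟨((1 : B.grp), U.left t), t, ?_, one_smul _ _⟩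
    change (1 : B.grp)⁻¹ • U.left t = U.left t
    rw [inv_one, one_smul]

theorem comp_id (U : GSpan A B) : Iso (comp U (id A)) U := by
  refine comp_iso_of (fun p q _ => ((1 : B.grp), q.1⁻¹) • p) ?_ ?_ ?_ ?_ ?_ ?_
  · intro p q h b h'
    change (((1 : B.grp), (b * q.1 * 1⁻¹)⁻¹) • ((1 : B.grp), b) • p) = _
    simp [smul_smul]
  · intro c a p q h h'
    change (((1 : B.grp), (1 * q.1 * a⁻¹)⁻¹) • (c, (1 : A.grp)) • p) = _
    simp [smul_smul]
  · intro p q h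
    rw [U.left_smul, one_smul]
  · intro p q h
    rw [U.right_smul, h]; rfl
  · rintro p ⟨g, x⟩ h p' ⟨g', x'⟩ h' E
    have h : U.right p = x := h
    have h' : U.right p' = x' := h'
    have E : ((1 : B.grp), g⁻¹) • p = ((1 : B.grp), g'⁻¹) • p' := E
    have hp : p' = ((1 : B.grp), g' * g⁻¹) • p := by
      rw [← inv_smul_eq_iff.2 E]
      simp [smul_smul]
    refine ⟨g' * g⁻¹, hp, Prod.ext (show g' = g' * g⁻¹ * g * 1⁻¹ by group) ?_⟩
    change x' = (g' * g⁻¹) • x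
    rw [← h', ← h, hp, U.right_smul]
  · intro t
    refine ⟨t, ((1 : A.grp), U.right t), rfl, ?_⟩
    change ((1 : B.grp), (1 : A.grp)⁻¹) • t = t
    rw [inv_one]; exact one_smul _ t

theorem comp_assoc (W : GSpan C D) (V : GSpan B C) (U : GSpan A B) :
    Iso (comp (comp W V) U) (comp W (comp V U)) := by
  let S := {s : W.pts × V.pts × U.pts // W.right s.1 = V.left s.2.1 ∧ V.right s.2.1 = U.left s.2.2}
  refine iso_of_corr (S := S)
    (fun s => CompPts.mk (V := comp W V) (CompPts.mk s.1.1 s.1.2.1 s.2.1) s.1.2.2 s.2.2)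
    (fun s => CompPts.mk (U := comp V U) s.1.1 (CompPts.mk s.1.2.1 s.1.2.2 s.2.2) s.2.1)
    ?_ ?_ ?_ ?_ (fun _ => rfl) (fun _ => rfl)
  · refine CompPts.ind fun x q h => ?_
    induction x using CompPts.ind with | h p r k => exact ⟨⟨(p, r, q), k, h⟩, rfl⟩
  · refine CompPts.ind fun p x h => ?_
    induction x using CompPts.ind with | h r q k => exact ⟨⟨(p, r, q), h, k⟩, rfl⟩
  · rintro ⟨⟨p, r, q⟩, h, k⟩ ⟨⟨p', r', q'⟩, h', k'⟩
    constructor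
    · intro E
      obtain ⟨b, e1, e2⟩ := CompPts.mk_eq_iff.1 E
      obtain ⟨c, e3, e4⟩ := CompPts.mk_eq_iff.1 ((CompPts.smul_mk _ _ _ _).symm.trans e1.symm)
      refine CompPts.mk_eq_iff.2 ⟨c, ?_, ?_⟩
      · simpa [← Prod.one_eq_mk] using e3
      · refine Eq.trans (CompPts.mk_eq_iff.2 ⟨b, ?_, ?_⟩).symm (CompPts.smul_mk _ _ _ _).symm
        · simpa [smul_smul] using e4
        · simpa [← Prod.one_eq_mk] using e2
    · intro E
      obtain ⟨c, e1, e2⟩ := CompPts.mk_eq_iff.1 E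
      obtain ⟨b, e3, e4⟩ := CompPts.mk_eq_iff.1 ((CompPts.smul_mk _ _ _ _).symm.trans e2.symm)
      refine CompPts.mk_eq_iff.2 ⟨b, ?_, ?_⟩
      · refine Eq.trans (CompPts.mk_eq_iff.2 ⟨c, ?_, ?_⟩).symm (CompPts.smul_mk _ _ _ _).symm
        · simpa [← Prod.one_eq_mk] using e1
        · simpa [smul_smul] using e3
      · simpa [← Prod.one_eq_mk] using e4
  · rintro ⟨d, a⟩ ⟨⟨p, r, q⟩, h, k⟩
    refine ⟨⟨((d, (1 : C.grp)) • p, r, ((1 : B.grp), a) • q), ?_, ?_⟩, ?_, ?_⟩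
    · rw [right_one_smul]; exact h
    · rw [left_one_smul]; exact k
    · refine CompPts.mk_eq_iff.2 ⟨1, Eq.trans ?_ (CompPts.smul_mk _ _ _ _).symm, ?_⟩
      · exact CompPts.mk_eq_iff.2 ⟨1, by simp [smul_smul], by simp [← Prod.one_eq_mk]⟩
      · simp [← Prod.one_eq_mk]
    · refine CompPts.mk_eq_iff.2 ⟨1, ?_, Eq.trans ?_ (CompPts.smul_mk _ _ _ _).symm⟩
      · simp [← Prod.one_eq_mk]
      · exact CompPts.mk_eq_iff.2 ⟨1, by simp [← Prod.one_eq_mk], by simp [smul_smul]⟩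

theorem comp_empty (V : GSpan B C) : Iso (comp V (empty A B)) (empty A C) :=
  comp_iso_of (fun _ q _ => q.elim) (fun _ q => q.elim) (fun _ _ _ q => q.elim)
    (fun _ q => q.elim) (fun _ q => q.elim) (fun _ q => q.elim) (fun t => t.elim)

theorem empty_comp (U : GSpan A B) : Iso (comp (empty B C) U) (empty A C) :=
  comp_iso_of (fun p _ _ => p.elim) (fun p => p.elim) (fun _ _ p => p.elim)
    (fun p => p.elim) (fun p => p.elim) (fun p => p.elim) (fun t => t.elim)

theorem comp_sum (V : GSpan B C) (U U' : GSpan A B) :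
    Iso (comp V (sum U U')) (sum (comp V U) (comp V U')) := by
  refine comp_iso_of (T := sum (comp V U) (comp V U'))
    (fun p q => match q with
      | .inl q => fun h => .inl (CompPts.mk p q h)
      | .inr q => fun h => .inr (CompPts.mk p q h)) ?_ ?_ ?_ ?_ ?_ ?_
  · rintro p (q | q) h b h'
    · exact congrArg Sum.inl (CompPts.mk_eq_iff.2 ⟨b, rfl, rfl⟩).symm
    · exact congrArg Sum.inr (CompPts.mk_eq_iff.2 ⟨b, rfl, rfl⟩).symm
  · rintro c a p (q | q) h h' <;> rfl
  · rintro p (q | q) h <;> rfl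
  · rintro p (q | q) h <;> rfl
  · rintro p (q | q) h p' (q' | q') h' E
    · obtain ⟨b, e1, e2⟩ := CompPts.mk_eq_iff.1 (Sum.inl.inj E)
      exact ⟨b, e1, congrArg Sum.inl e2⟩
    · cases E
    · cases E
    · obtain ⟨b, e1, e2⟩ := CompPts.mk_eq_iff.1 (Sum.inr.inj E)
      exact ⟨b, e1, congrArg Sum.inr e2⟩
  · rintro (x | x)
    · induction x using CompPts.ind with | h p q h => exact ⟨p, .inl q, h, rfl⟩
    · induction x using CompPts.ind with | h p q h => exact ⟨p, .inr q, h, rfl⟩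

theorem sum_comp (V V' : GSpan B C) (U : GSpan A B) :
    Iso (comp (sum V V') U) (sum (comp V U) (comp V' U)) := by
  refine comp_iso_of (T := sum (comp V U) (comp V' U))
    (fun p q => match p with
      | .inl p => fun h => .inl (CompPts.mk p q h)
      | .inr p => fun h => .inr (CompPts.mk p q h)) ?_ ?_ ?_ ?_ ?_ ?_
  · rintro (p | p) q h b h'
    · exact congrArg Sum.inl (CompPts.mk_eq_iff.2 ⟨b, rfl, rfl⟩).symm
    · exact congrArg Sum.inr (CompPts.mk_eq_iff.2 ⟨b, rfl, rfl⟩).symm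
  · rintro c a (p | p) q h h' <;> rfl
  · rintro (p | p) q h <;> rfl
  · rintro (p | p) q h <;> rfl
  · rintro (p | p) q h (p' | p') q' h' E
    · obtain ⟨b, e1, e2⟩ := CompPts.mk_eq_iff.1 (Sum.inl.inj E)
      exact ⟨b, congrArg Sum.inl e1, e2⟩
    · cases E
    · cases E
    · obtain ⟨b, e1, e2⟩ := CompPts.mk_eq_iff.1 (Sum.inr.inj E)
      exact ⟨b, congrArg Sum.inr e1, e2⟩
  · rintro (x | x)
    · induction x using CompPts.ind with | h p q h => exact ⟨.inl p, q, h, rfl⟩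
    · induction x using CompPts.ind with | h p q h => exact ⟨.inr p, q, h, rfl⟩

theorem sum_congr {U U' V V' : GSpan A B} :
    Iso U U' → Iso V V' → Iso (sum U V) (sum U' V') := by
  rintro ⟨e, h1, h2, h3⟩ ⟨f, k1, k2, k3⟩
  refine ⟨Equiv.sumCongr e f, ?_, ?_, ?_⟩
  · rintro a (p | p)
    · exact congrArg Sum.inl (h1 a p)
    · exact congrArg Sum.inr (k1 a p)
  · rintro (p | p)
    · exact h2 p
    · exact k2 p
  · rintro (p | p)
    · exact h3 p
    · exact k3 p

theorem sum_comm (U V : GSpan A B) : Iso (sum U V) (sum V U) := by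
  refine ⟨Equiv.sumComm _ _, ?_, ?_, ?_⟩
  · rintro a (p | p) <;> rfl
  · rintro (p | p) <;> rfl
  · rintro (p | p) <;> rfl

theorem sum_assoc (U V W : GSpan A B) : Iso (sum (sum U V) W) (sum U (sum V W)) := by
  refine ⟨Equiv.sumAssoc _ _ _, ?_, ?_, ?_⟩
  · rintro a ((p | p) | p) <;> rfl
  · rintro ((p | p) | p) <;> rfl
  · rintro ((p | p) | p) <;> rfl

theorem sum_empty (U : GSpan A B) : Iso (sum U (empty A B)) U := by
  refine ⟨Equiv.sumEmpty U.pts PEmpty, ?_, ?_, ?_⟩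
  · rintro a (p | p)
    · rfl
    · exact p.elim
  · rintro (p | p)
    · rfl
    · exact p.elim
  · rintro (p | p)
    · rfl
    · exact p.elim

end GSpan

/-- Isomorphism classes of spans from `X / G` to `Y / H`. -/
def SpanClass (A B : GFrac.{u}) : Type (u + 1) := Quotient (GSpan.setoid A B)

namespace SpanClass

variable {A B C D : GFrac.{u}}

/-- The isomorphism class of a span. -/
def mk (U : GSpan A B) : SpanClass A B := Quotient.mk _ U

theorem ind {P : SpanClass A B → Prop} (h : ∀ U, P (mk U)) (x : SpanClass A B) : P x :=
  Quotient.inductionOn x h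

theorem sound {U U' : GSpan A B} (h : GSpan.Iso U U') : mk U = mk U' := Quotient.sound h

instance : Zero (SpanClass A B) := ⟨mk (GSpan.empty A B)⟩

instance : Add (SpanClass A B) :=
  ⟨Quotient.map₂ GSpan.sum fun _ _ h _ _ k => GSpan.sum_congr h k⟩

/-- Isomorphism classes of spans form a commutative monoid under disjoint union. -/
instance : AddCommMonoid (SpanClass A B) where
  add_assoc := ind fun U => ind fun V => ind fun W => sound (GSpan.sum_assoc U V W)
  add_comm := ind fun U => ind fun V => sound (GSpan.sum_comm U V)
  add_zero := ind fun U => sound (GSpan.sum_empty U)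
  zero_add := ind fun U => sound ((GSpan.sum_comm _ _).trans (GSpan.sum_empty U))
  nsmul := nsmulRec

/-- Composition of isomorphism classes of spans, a biadditive map. -/
def comp (A B C : GFrac.{u}) : SpanClass B C →+ SpanClass A B →+ SpanClass A C where
  toFun x :=
    { toFun := fun y => Quotient.map₂ GSpan.comp (fun _ _ h _ _ k => GSpan.comp_congr h k) x y
      map_zero' := by
        induction x using SpanClass.ind with | h V => exact sound (GSpan.comp_empty V)
      map_add' := by
        induction x using SpanClass.ind with | h V =>
        exact ind fun U => ind fun U' => sound (GSpan.comp_sum V U U') }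
  map_zero' := AddMonoidHom.ext <| ind fun U => sound (GSpan.empty_comp U)
  map_add' := ind fun V => ind fun V' => AddMonoidHom.ext <| ind fun U =>
    sound (GSpan.sum_comp V V' U)

theorem comp_mk (V : GSpan B C) (U : GSpan A B) :
    comp A B C (mk V) (mk U) = mk (GSpan.comp V U) := rfl

end SpanClass

/-- The Burnside group `B^{H, G}(Y, X)`: the Grothendieck group of the isomorphism classes of spans
`Y ← U → X`, for disjoint union. -/
abbrev SpanBurnside (A B : GFrac.{u}) : Type (u + 1) :=
  Algebra.GrothendieckAddGroup (SpanClass A B)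

namespace SpanBurnside

variable {A B C D : GFrac.{u}}

/-- The element `⟨U, β, α⟩` of the Burnside group. -/
noncomputable def mk (U : GSpan A B) : SpanBurnside A B :=
  Algebra.GrothendieckAddGroup.of (SpanClass.mk U)

/-- Additive maps out of the Burnside group are determined by their values at spans. -/
theorem hom_ext {T : Type*} [AddCommGroup T] {f g : SpanBurnside A B →+ T}
    (h : ∀ U, f (mk U) = g (mk U)) : f = g :=
  Algebra.GrothendieckAddGroup.lift.symm.injective (AddMonoidHom.ext (SpanClass.ind h))

/-- An additive map on isomorphism classes of spans, extended to the Burnside group. -/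
noncomputable def lift {T : Type*} [AddCommGroup T] (f : SpanClass A B →+ T) :
    SpanBurnside A B →+ T := Algebra.GrothendieckAddGroup.lift f

theorem lift_mk {T : Type*} [AddCommGroup T] (f : SpanClass A B →+ T) (U : GSpan A B) :
    lift f (mk U) = f (SpanClass.mk U) :=
  DFunLike.congr_fun (Algebra.GrothendieckAddGroup.lift.symm_apply_apply f) (SpanClass.mk U)

/-- The biadditive extension of the composition of spans to the Burnside groups. -/
noncomputable def comp (A B C : GFrac.{u}) :
    SpanBurnside B C →+ SpanBurnside A B →+ SpanBurnside A C :=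
  lift
    { toFun := fun x => lift (Algebra.GrothendieckAddGroup.of.comp (SpanClass.comp A B C x))
      map_zero' := hom_ext fun U => by
        rw [lift_mk]; simp
      map_add' := fun x y => hom_ext fun U => by
        rw [AddMonoidHom.add_apply, lift_mk, lift_mk, lift_mk]; simp }

theorem comp_mk (V : GSpan B C) (U : GSpan A B) : comp A B C (mk V) (mk U) = mk (V.comp U) := by
  unfold comp
  rw [lift_mk]
  exact lift_mk _ U

theorem id_comp (x : SpanBurnside A B) : comp A B B (mk (GSpan.id B)) x = x := by
  have : comp A B B (mk (GSpan.id B)) = AddMonoidHom.id _ := hom_ext fun U => by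
    rw [comp_mk]
    exact congrArg Algebra.GrothendieckAddGroup.of (SpanClass.sound (GSpan.id_comp U))
  exact DFunLike.congr_fun this x

theorem comp_id (x : SpanBurnside A B) : comp A A B x (mk (GSpan.id A)) = x := by
  have : (comp A A B).flip (mk (GSpan.id A)) = AddMonoidHom.id _ := hom_ext fun U => by
    rw [AddMonoidHom.flip_apply, comp_mk]
    exact congrArg Algebra.GrothendieckAddGroup.of (SpanClass.sound (GSpan.comp_id U))
  exact DFunLike.congr_fun this x

theorem comp_assoc (z : SpanBurnside C D) (y : SpanBurnside B C) (x : SpanBurnside A B) :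
    comp A B D (comp B C D z y) x = comp A C D z (comp A B C y x) := by
  have h1 : ∀ (W : GSpan C D) (V : GSpan B C) (x : SpanBurnside A B),
      comp A B D (comp B C D (mk W) (mk V)) x = comp A C D (mk W) (comp A B C (mk V) x) := by
    intro W V x
    have : comp A B D (comp B C D (mk W) (mk V)) =
        (comp A C D (mk W)).comp (comp A B C (mk V)) := hom_ext fun U => by
      rw [AddMonoidHom.comp_apply, comp_mk, comp_mk, comp_mk, comp_mk]
      exact congrArg Algebra.GrothendieckAddGroup.of (SpanClass.sound (GSpan.comp_assoc W V U))
    exact DFunLike.congr_fun this x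
  have h2 : ∀ (W : GSpan C D) (y : SpanBurnside B C) (x : SpanBurnside A B),
      comp A B D (comp B C D (mk W) y) x = comp A C D (mk W) (comp A B C y x) := by
    intro W y x
    have : ((comp A B D).flip x).comp (comp B C D (mk W)) =
        (comp A C D (mk W)).comp ((comp A B C).flip x) := hom_ext fun V => h1 W V x
    exact DFunLike.congr_fun this y
  have : ((comp A B D).flip x).comp ((comp B C D).flip y) =
      (comp A C D).flip (comp A B C y x) := hom_ext fun W => h2 W y x
  exact DFunLike.congr_fun this z

end SpanBurnside

section RBurnside

variable (R : Type v) [CommRing R]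

/-- The `R`-module `RB^{H, G}(Y, X) = R ⊗_ℤ B^{H, G}(Y, X)`. -/
abbrev RBurnside (A B : GFrac.{u}) : Type (max v (u + 1)) := R ⊗[ℤ] SpanBurnside A B

namespace RBurnside

variable {A B C D : GFrac.{u}}

/-- The `R`-bilinear extension of the composition of spans,
`(s ⊗ y) ∘ (r ⊗ x) = s r ⊗ (y ∘ x)`. -/
noncomputable def comp (A B C : GFrac.{u}) :
    RBurnside R B C →ₗ[R] RBurnside R A B →ₗ[R] RBurnside R A C :=
  LinearMap.liftBaseChange R
    ((LinearMap.baseChangeHom ℤ R (SpanBurnside A B) (SpanBurnside A C)).comp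
      (AddMonoidHom.toIntLinearMap
        ((addMonoidHomLequivInt (A := SpanBurnside A B) (B := SpanBurnside A C)
          ℤ).toAddMonoidHom.comp (SpanBurnside.comp A B C))))

theorem comp_tmul (s r : R) (y : SpanBurnside B C) (x : SpanBurnside A B) :
    comp R A B C (s ⊗ₜ y) (r ⊗ₜ x) = (s * r) ⊗ₜ SpanBurnside.comp A B C y x := by
  simp [comp, TensorProduct.smul_tmul']

/-- The identity morphism of `X / G`. -/
noncomputable def one (A : GFrac.{u}) : RBurnside R A A := 1 ⊗ₜ SpanBurnside.mk (GSpan.id A)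

theorem one_comp (x : RBurnside R A B) : comp R A B B (one R B) x = x := by
  induction x using TensorProduct.induction_on with
  | zero => simp
  | tmul r x => rw [one, comp_tmul, one_mul, SpanBurnside.id_comp]
  | add x y hx hy => rw [map_add, hx, hy]

theorem comp_one (x : RBurnside R A B) : comp R A A B x (one R A) = x := by
  induction x using TensorProduct.induction_on with
  | zero => simp
  | tmul r x => rw [one, comp_tmul, mul_one, SpanBurnside.comp_id]
  | add x y hx hy => rw [map_add, LinearMap.add_apply, hx, hy]

theorem comp_assoc (z : RBurnside R C D) (y : RBurnside R B C) (x : RBurnside R A B) :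
    comp R A B D (comp R B C D z y) x = comp R A C D z (comp R A B C y x) := by
  induction z using TensorProduct.induction_on with
  | zero => simp
  | add z z' hz hz' => simp only [map_add, LinearMap.add_apply, hz, hz']
  | tmul t z =>
    induction y using TensorProduct.induction_on with
    | zero => simp
    | add y y' hy hy' => simp only [map_add, LinearMap.add_apply, hy, hy']
    | tmul s y =>
      induction x using TensorProduct.induction_on with
      | zero => simp
      | add x x' hx hx' => simp only [map_add, hx, hx']
      | tmul r x =>
        simp only [comp_tmul, SpanBurnside.comp_assoc, mul_assoc]

end RBurnside

end RBurnside

/-- The objects of the category `𝒞_R`: fractions `X / G`. -/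
structure FracCat (R : Type v) [CommRing R] : Type (u + 1) where
  /-- the underlying couple `(G, X)` -/
  frac : GFrac.{u}

/-- The category `𝒞_R`: the morphisms from `X / G` to `Y / H` are the elements of
`RB^{H, G}(Y, X)`. -/
noncomputable instance FracCat.category (R : Type v) [CommRing R] :
    Category.{max v (u + 1)} (FracCat.{v, u} R) where
  Hom A B := RBurnside R A.frac B.frac
  id A := RBurnside.one R A.frac
  comp f g := RBurnside.comp R _ _ _ g f
  id_comp f := RBurnside.comp_one R f
  comp_id f := RBurnside.one_comp R f
  assoc f g h := (RBurnside.comp_assoc R h g f).symm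

/-- The object `X / G` of `𝒞_R`. -/
def FracCat.of (R : Type v) [CommRing R] (G X : Type u) [Group G] [Finite G] [MulAction G X]
    [Finite X] : FracCat.{v, u} R := ⟨{ grp := G, pts := X }⟩

/-- The `G`-set `X` is the disjoint union of the orbits `O 1, …, O n`, and `S i` is the stabilizer
of an element of `O i`. -/
structure IsOrbitDecomposition {G X : Type*} [Group G] [MulAction G X] {n : ℕ}
    (O : Fin n → Set X) (S : Fin n → Subgroup G) : Prop where
  pairwise_disjoint : Pairwise fun i j => Disjoint (O i) (O j)
  iUnion_eq : ⋃ i, O i = Set.univ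
  orbit_stabilizer : ∀ i, ∃ x, O i = MulAction.orbit G x ∧ S i = MulAction.stabilizer G x

/-! Fix a finite group `K` and look at the morphisms from `• / K` to `Y / H`, which are generated by
transitive spans. Such a span is determined by the image `y` in `Y` of one of its points and the
stabilizer `L ≤ H × K` of that point. Call it essential if `L` meets `1 × K` trivially and projects
onto `K`, that is, if `L` is the graph of a surjection onto `K` from a subgroup of the stabilizer of
`y`. A point `[v, u]` of a composite can only be essential if `u` is (`IsEssential.of_comp`), so
post-composition preserves the submodule generated by the spans without essential points. Modulo
this submodule, the morphisms form a free `R`-module whose rank is the number of conjugacy classes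
of essential pairs `(y, L)`. An isomorphism `X / G ≅ Y / H` therefore forces these numbers to agree
for every `K`.

The quotient is never formed. It is replaced by its dual, the linear forms `weightForm f`, which sum
a function `f` of the essential class over the orbits of a span. `card_essentialClass_le` compares
ranks with these forms.

The number of classes is additive over orbits (`card_eq_sum`): an orbit with stabilizer `S`
contributes the number `N(K, S)` of classes for `S` acting on a point. Now `N(K, K) ≠ 0`, and `N(K,
S) ≠ 0` makes `K` a quotient of a subgroup of `S`, so that `K ≅ S` or `|K| < |S|`. The matrix `N` is
thus triangular on isomorphism classes of finite groups, and the sums `∑ N(K, S i)` for all `K`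
determine the multiset of stabilizers up to isomorphism. -/

/-! ### Multisets and triangular families of functions -/

/-- A multiset is determined by its sums against a family of functions `N a` that is unitriangular
up to nonzero diagonal entries, with respect to some size function. -/
theorem Multiset.eq_of_sum_map_eq_of_triangular {α : Type*} (N : α → α → ℕ) (size : α → ℕ)
    (hdiag : ∀ a, N a a ≠ 0) (htri : ∀ a b, N a b ≠ 0 → a = b ∨ size a < size b)
    (s t : Multiset α) (h : ∀ a, (s.map (N a)).sum = (t.map (N a)).sum) : s = t := by
  classical
  by_contra hst
  -- Cancel the common part `s ∩ t`: the differences `s - t` and `t - s` have equal sums and no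
  -- common element.
  have h' : ∀ a, ((s - t).map (N a)).sum = ((t - s).map (N a)).sum := by
    intro a
    have h1 := congrArg (fun r => (Multiset.map (N a) r).sum) (Multiset.sub_add_inter s t)
    have h2 := congrArg (fun r => (Multiset.map (N a) r).sum) (Multiset.sub_add_inter t s)
    simp only [Multiset.map_add, Multiset.sum_add, Multiset.inter_comm t s] at h1 h2
    have h3 : (s.map (N a)).sum = (t.map (N a)).sum := h a
    rw [← h1, ← h2] at h3
    exact Nat.add_right_cancel h3
  have hdisj : ∀ a, a ∈ s - t → a ∈ t - s → False := by
    intro a ha hb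
    rw [Multiset.mem_sub] at ha hb
    omega
  -- If no element of `t'` were larger than `a`, then `N a` would vanish on all of `t'` but not at
  -- `a ∈ s'`.
  have key : ∀ s' t' : Multiset α, (∀ a, (s'.map (N a)).sum = (t'.map (N a)).sum) →
      (∀ a, a ∈ s' → a ∈ t' → False) →
      ∀ a ∈ s', ∃ b ∈ t', size a < size b := by
    intro s' t' hs hd a ha
    by_contra! hlt
    have h0 : (t'.map (N a)).sum = 0 := by
      refine Multiset.sum_eq_zero fun x hx => ?_
      obtain ⟨b, hb, rfl⟩ := Multiset.mem_map.1 hx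
      by_contra hne
      rcases htri a b hne with rfl | hab
      · exact hd _ ha hb
      · exact absurd hab (hlt b hb).not_gt
    rw [← hs a, Multiset.sum_eq_zero_iff] at h0
    exact hdiag a (h0 _ (Multiset.mem_map_of_mem _ ha))
  have hne : ((s - t) + (t - s)).toFinset.Nonempty := by
    rw [Multiset.toFinset_nonempty]
    intro h0
    rw [add_eq_zero] at h0
    refine hst (le_antisymm ?_ ?_)
    · exact tsub_eq_zero_iff_le.1 h0.1
    · exact tsub_eq_zero_iff_le.1 h0.2
  -- An element of maximal size in either difference is exceeded by one in the other.
  obtain ⟨a, ha, hmax⟩ := Finset.exists_max_image _ size hne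
  simp only [Multiset.mem_toFinset, Multiset.mem_add] at ha hmax
  rcases ha with ha | ha
  · obtain ⟨b, hb, hab⟩ := key _ _ h' hdisj a ha
    exact absurd (hmax b (Or.inr hb)) hab.not_ge
  · obtain ⟨b, hb, hab⟩ := key _ _ (fun a => (h' a).symm) (fun a h1 h2 => hdisj a h2 h1) a ha
    exact absurd (hmax b (Or.inl hb)) hab.not_ge

/-- The multiplicity of `c` is the cardinality of the fibre over `c`, so bijections between fibres
can be glued. -/
theorem exists_equiv_comp_eq_of_map_univ_eq {ι κ α : Type*} [Fintype ι] [Fintype κ] (f : ι → α)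
    (g : κ → α) (h : Finset.univ.val.map f = Finset.univ.val.map g) :
    ∃ e : ι ≃ κ, ∀ i, g (e i) = f i := by
  classical
  have hc : ∀ c, Nonempty ({i // f i = c} ≃ {j // g j = c}) := fun c => by
    have := congrArg (Multiset.count c) h
    rw [Multiset.count_map, Multiset.count_map, ← Finset.filter_val, ← Finset.filter_val] at this
    refine ⟨Fintype.equivOfCardEq ?_⟩
    rw [Fintype.card_subtype, Fintype.card_subtype]
    simpa only [eq_comm, Finset.card_val] using this
  exact ⟨Equiv.ofFiberEquiv fun c => (hc c).some, Equiv.ofFiberEquiv_map _⟩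

/-! ### Essential pairs and their number -/

/-- A point `x` of the `G`-set `X` together with a subgroup of `G × K` fixing `x` which is the
graph of a surjective homomorphism from a subgroup of `G` onto `K`. -/
@[ext]
structure EssentialPair (K G X : Type*) [Group K] [Group G] [MulAction G X] where
  /-- the point -/
  pt : X
  /-- the subgroup -/
  sub : Subgroup (G × K)
  smul_eq : ∀ a ∈ sub, a.1 • pt = pt
  eq_one : ∀ k, ((1 : G), k) ∈ sub → k = 1
  exists_mem : ∀ k, ∃ g, (g, k) ∈ sub

namespace EssentialPair

variable {K G X : Type*} [Group K] [Group G] [MulAction G X]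

instance [Finite K] [Finite G] [Finite X] : Finite (EssentialPair K G X) :=
  Finite.of_injective (β := X × Subgroup (G × K)) (fun p => (p.pt, p.sub)) fun _ _ h =>
    EssentialPair.ext (congrArg Prod.fst h) (congrArg Prod.snd h)

/-- Conjugacy of pairs under `G × K`. -/
instance setoid (K G X : Type*) [Group K] [Group G] [MulAction G X] :
    Setoid (EssentialPair K G X) where
  r p q := ∃ a : G × K, a.1 • p.pt = q.pt ∧ ∀ b, b ∈ q.sub ↔ a⁻¹ * b * a ∈ p.sub
  iseqv :=
    { refl := fun p => ⟨1, one_smul _ _, fun b => by simp⟩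
      symm := by
        rintro p q ⟨a, h1, h2⟩
        exact ⟨a⁻¹, by rw [← h1, Prod.fst_inv, inv_smul_smul], fun b => by
          rw [h2, show a⁻¹ * (a⁻¹⁻¹ * b * a⁻¹) * a = b by group]⟩
      trans := by
        rintro p q r ⟨a, h1, h2⟩ ⟨b, h3, h4⟩
        exact ⟨b * a, by rw [Prod.fst_mul, mul_smul, h1, h3], fun c => by
          rw [h4, h2, show a⁻¹ * (b⁻¹ * c * b) * a = (b * a)⁻¹ * c * (b * a) by group]⟩ }

end EssentialPair

/-- Conjugacy classes of essential pairs. -/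
def EssentialClass (K G X : Type*) [Group K] [Group G] [MulAction G X] : Type _ :=
  Quotient (EssentialPair.setoid K G X)

namespace EssentialClass

variable {K G X : Type*} [Group K] [Group G] [MulAction G X]

instance [Finite K] [Finite G] [Finite X] : Finite (EssentialClass K G X) :=
  Quotient.finite _

/-- The essential pair over a point induced from a pair over its stabilizer. -/
def ofStabilizer (K : Type*) [Group K] {S : Subgroup G} {x : X}
    (hS : S = MulAction.stabilizer G x) (p : EssentialPair K S Unit) : EssentialPair K G X where
  pt := x
  sub := p.sub.map (S.subtype.prodMap (MonoidHom.id K))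
  smul_eq := by
    rintro _ ⟨⟨s, k⟩, -, rfl⟩
    have : (s : G) ∈ MulAction.stabilizer G x := hS ▸ s.2
    exact this
  eq_one := by
    rintro k ⟨⟨s, k'⟩, h, e⟩
    obtain ⟨e1, e2⟩ := Prod.mk.inj e
    obtain rfl : s = 1 := Subtype.ext e1
    obtain rfl : k' = k := e2
    exact p.eq_one _ h
  exists_mem := fun k => by
    obtain ⟨s, hs⟩ := p.exists_mem k
    exact ⟨s, (s, k), hs, rfl⟩

theorem mem_ofStabilizer {S : Subgroup G} {x : X} (hS : S = MulAction.stabilizer G x)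
    (p : EssentialPair K S Unit) (s : S) (k : K) :
    ((s : G), k) ∈ (ofStabilizer K hS p).sub ↔ (s, k) ∈ p.sub := by
  constructor
  · rintro ⟨⟨s', k'⟩, h, e⟩
    obtain ⟨e1, e2⟩ := Prod.mk.inj e
    obtain rfl : s' = s := Subtype.ext e1
    obtain rfl : k' = k := e2
    exact h
  · exact fun h => ⟨(s, k), h, rfl⟩

theorem mem_of_mem_ofStabilizer {S : Subgroup G} {x : X} (hS : S = MulAction.stabilizer G x)
    (p : EssentialPair K S Unit) (a : G × K) (ha : a ∈ (ofStabilizer K hS p).sub) : a.1 ∈ S := by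
  obtain ⟨⟨s, k⟩, -, rfl⟩ := ha
  exact s.2

/-- The class over a `G`-set induced from a class over a point stabilizer. -/
def induce (K : Type*) [Group K] {S : Subgroup G} {x : X} (hS : S = MulAction.stabilizer G x) :
    EssentialClass K S Unit → EssentialClass K G X :=
  Quotient.map (ofStabilizer K hS) (by
    rintro p q ⟨⟨s, k⟩, -, h⟩
    have hs : (s : G) ∈ MulAction.stabilizer G x := hS ▸ s.2
    refine ⟨((s : G), k), hs, fun ⟨g, l⟩ => ?_⟩
    -- Both subgroups lie in `S × K` and `s ∈ S`, so for `g ∉ S` neither side holds.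
    by_cases hg : g ∈ S
    · lift g to S using hg
      rw [mem_ofStabilizer, h]
      exact (mem_ofStabilizer hS p (s⁻¹ * g * s) (k⁻¹ * l * k)).symm
    · constructor
      · exact fun h' => absurd (mem_of_mem_ofStabilizer hS q _ h') hg
      · intro h'
        have h1 : (s : G)⁻¹ * g * s ∈ S := mem_of_mem_ofStabilizer hS p _ h'
        refine absurd ?_ hg
        have := S.mul_mem (S.mul_mem s.2 h1) (S.inv_mem s.2)
        rwa [show (s : G) * ((s : G)⁻¹ * g * s) * (s : G)⁻¹ = g by group] at this)

/-- Every pair can be moved to one over a chosen base point `x i`. An element conjugating two pairs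
over base points shows that these lie in one orbit, hence coincide; its `G`-component then fixes `x
i`, so the conjugacy already takes place over `S i`. -/
theorem induce_bijective {n : ℕ} (K : Type*) [Group K] {O : Fin n → Set X}
    {S : Fin n → Subgroup G} (hX : IsOrbitDecomposition O S) (x : Fin n → X)
    (hO : ∀ i, O i = MulAction.orbit G (x i)) (hS : ∀ i, S i = MulAction.stabilizer G (x i)) :
    Function.Bijective (fun c : Σ i, EssentialClass K (S i) Unit => induce K (hS c.1) c.2) := by
  constructor
  · rintro ⟨i, c⟩ ⟨j, d⟩ e
    induction c using Quotient.inductionOn with | h p => ?_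
    induction d using Quotient.inductionOn with | h q => ?_
    obtain ⟨⟨g, k⟩, h1, h2⟩ := Quotient.exact e
    have h1 : g • x i = x j := h1
    obtain rfl : i = j := by
      by_contra hij
      have h2 : x j ∈ O i := by rw [hO]; exact ⟨g, h1⟩
      have h3 : x j ∈ O j := by rw [hO]; exact MulAction.mem_orbit_self _
      exact Set.disjoint_left.1 (hX.pairwise_disjoint hij) h2 h3
    have hg : g ∈ S i := by rw [hS]; exact h1
    lift g to S i using hg
    refine congrArg (Sigma.mk i) (Quotient.sound ⟨(g, k), rfl, fun ⟨s, l⟩ => ?_⟩)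
    rw [← mem_ofStabilizer (hS i), h2]
    exact mem_ofStabilizer (hS i) p (g⁻¹ * s * g) (k⁻¹ * l * k)
  · intro c
    induction c using Quotient.inductionOn with | h p => ?_
    obtain ⟨i, hi⟩ : ∃ i, p.pt ∈ O i := by
      rw [← Set.mem_iUnion, hX.iUnion_eq]; trivial
    rw [hO] at hi
    obtain ⟨g, hg⟩ := hi
    have hg : g • x i = p.pt := hg
    -- Since `g` sends `x i` to the point of `p`, pulling `p.sub` back along conjugation by `g`
    -- moves the pair to `x i`. Nothing is lost, by `hmem`: elements of `p.sub` come from the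
    -- stabilizer of `x i`.
    let conj : S i × K →* G × K :=
      (MulAut.conj ((g, 1) : G × K)).toMonoidHom.comp ((S i).subtype.prodMap (MonoidHom.id K))
    have hconj : ∀ s k, conj (s, k) = (g * s * g⁻¹, k) := fun s k => by
      simp [conj]
    have hmem : ∀ h k, (h, k) ∈ p.sub → g⁻¹ * h * g ∈ S i := by
      intro h k hk
      have := p.smul_eq _ hk
      rw [hS, MulAction.mem_stabilizer_iff, mul_smul, mul_smul, hg, this, ← hg, inv_smul_smul]
    let q : EssentialPair K (S i) Unit :=
      { pt := ()
        sub := p.sub.comap conj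
        smul_eq := fun _ _ => rfl
        eq_one := fun k hk => p.eq_one k (by
          rw [Subgroup.mem_comap, hconj] at hk
          simpa using hk)
        exists_mem := fun k => by
          obtain ⟨h, hk⟩ := p.exists_mem k
          refine ⟨⟨g⁻¹ * h * g, hmem h k hk⟩, ?_⟩
          rw [Subgroup.mem_comap, hconj]
          simpa [mul_assoc] using hk }
    refine ⟨⟨i, Quotient.mk _ q⟩, Quotient.sound ⟨(g, 1), hg, fun ⟨h, k⟩ => ?_⟩⟩
    have hq : ∀ s : S i, ((s : G), k) ∈ (ofStabilizer K (hS i) q).sub ↔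
        (g * s * g⁻¹, k) ∈ p.sub := fun s => by
      rw [mem_ofStabilizer, Subgroup.mem_comap, hconj]
    have e : ((g, 1) : G × K)⁻¹ * (h, k) * (g, 1) = (g⁻¹ * h * g, k) := by simp
    rw [e]
    constructor
    · intro hk
      exact (hq ⟨_, hmem h k hk⟩).2 (by simpa [mul_assoc] using hk)
    · intro hk
      simpa [mul_assoc] using (hq ⟨_, mem_of_mem_ofStabilizer _ _ _ hk⟩).1 hk

theorem card_eq_sum [Finite K] [Finite G] {n : ℕ} {O : Fin n → Set X}
    {S : Fin n → Subgroup G} (hX : IsOrbitDecomposition O S) :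
    Nat.card (EssentialClass K G X) = ∑ i, Nat.card (EssentialClass K (S i) Unit) := by
  choose x hO hS using hX.orbit_stabilizer
  rw [← Nat.card_eq_of_bijective _ (induce_bijective K hX x hO hS), Nat.card_sigma]

/-- Transport of classes over a point along isomorphisms of the two groups. -/
def map {K' G' : Type*} [Group K'] [Group G'] (e : G ≃* G') (f : K ≃* K') :
    EssentialClass K G Unit → EssentialClass K' G' Unit :=
  Quotient.map (fun p =>
    { pt := ()
      sub := p.sub.comap (e.symm.toMonoidHom.prodMap f.symm.toMonoidHom)
      smul_eq := fun _ _ => rfl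
      eq_one := fun k hk => by
        simpa using p.eq_one (f.symm k) (by simpa using hk)
      exists_mem := fun k => by
        obtain ⟨g, hg⟩ := p.exists_mem (f.symm k)
        exact ⟨e g, by simpa using hg⟩ }) (by
    rintro p q ⟨⟨g, k⟩, -, h⟩
    exact ⟨(e g, f k), rfl, fun ⟨b, c⟩ => by simp [h]⟩)

theorem map_map_symm {K' G' : Type*} [Group K'] [Group G'] (e : G ≃* G') (f : K ≃* K')
    (c : EssentialClass K G Unit) : map e.symm f.symm (map e f c) = c := by
  induction c using Quotient.inductionOn with | h p => ?_
  refine congrArg (Quotient.mk _) (EssentialPair.ext rfl ?_)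
  ext ⟨a, b⟩
  simp

theorem card_congr {K' G' : Type*} [Group K'] [Group G'] (e : G ≃* G') (f : K ≃* K') :
    Nat.card (EssentialClass K G Unit) = Nat.card (EssentialClass K' G' Unit) :=
  Nat.card_congr ⟨map e f, map e.symm f.symm, map_map_symm e f, map_map_symm e.symm f.symm⟩

/-- The diagonal of `K × K` is the graph of the identity. -/
theorem card_self_ne_zero (K : Type*) [Group K] [Finite K] :
    Nat.card (EssentialClass K K Unit) ≠ 0 := by
  have : Nonempty (EssentialClass K K Unit) :=
    ⟨Quotient.mk _
      { pt := ()
        sub := ((MonoidHom.id K).prod (MonoidHom.id K)).range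
        smul_eq := fun _ _ => rfl
        eq_one := by
          rintro k ⟨l, hl⟩
          obtain ⟨h1, h2⟩ := Prod.mk.inj hl
          exact h2.symm.trans h1
        exists_mem := fun k => ⟨k, k, rfl⟩ }⟩
  exact Nat.card_pos.ne'

/-- The subgroup of an essential pair embeds in `G` by the first projection and maps onto `K` by the
second, so `|K| ≤ |G|`; in case of equality both projections are isomorphisms. -/
theorem nonempty_mulEquiv_or_card_lt [Finite G]
    (h : Nat.card (EssentialClass K G Unit) ≠ 0) :
    Nonempty (K ≃* G) ∨ Nat.card K < Nat.card G := by
  obtain ⟨⟨c⟩, -⟩ := Nat.card_ne_zero.1 h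
  induction c using Quotient.inductionOn with | h p => ?_
  have hinj : Function.Injective ((MonoidHom.fst G K).comp p.sub.subtype) := by
    rw [injective_iff_map_eq_one]
    rintro ⟨⟨g, k⟩, hp⟩ hg
    obtain rfl : g = 1 := hg
    obtain rfl := p.eq_one k hp
    rfl
  have hsurj : Function.Surjective ((MonoidHom.snd G K).comp p.sub.subtype) := fun k => by
    obtain ⟨g, hg⟩ := p.exists_mem k
    exact ⟨⟨_, hg⟩, rfl⟩
  have : Finite p.sub := Finite.of_injective _ hinj
  have h1 := Nat.card_le_card_of_injective _ hinj
  have h2 := Nat.card_le_card_of_surjective _ hsurj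
  rcases (h2.trans h1).lt_or_eq with hlt | heq
  · exact Or.inr hlt
  · have b1 := (Nat.bijective_iff_injective_and_card _).2 ⟨hinj, by omega⟩
    have b2 := (Nat.bijective_iff_surjective_and_card _).2 ⟨hsurj, by omega⟩
    exact Or.inl ⟨(MulEquiv.ofBijective _ b2).symm.trans (MulEquiv.ofBijective _ b1)⟩

end EssentialClass

/-! ### Recovering the groups from the numbers of classes -/

/-- Isomorphism of finite groups, as a setoid. -/
def FiniteGrp.isoSetoid : Setoid FiniteGrp.{u} where
  r A B := Nonempty (A ≃* B)
  iseqv := ⟨fun _ => ⟨MulEquiv.refl _⟩, fun ⟨e⟩ => ⟨e.symm⟩, fun ⟨e⟩ ⟨f⟩ => ⟨e.trans f⟩⟩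

/-- Two finite families of finite groups that have as many essential classes for every finite group
agree up to isomorphism and permutation. -/
theorem exists_perm_mulEquiv_of_card_essentialClass_eq {n m : ℕ} (P : Fin n → FiniteGrp.{u})
    (Q : Fin m → FiniteGrp.{u})
    (h : ∀ K : FiniteGrp.{u}, ∑ i, Nat.card (EssentialClass K (P i) Unit) =
      ∑ j, Nat.card (EssentialClass K (Q j) Unit)) :
    ∃ hnm : n = m, ∃ σ : Equiv.Perm (Fin n), ∀ i, Nonempty (P i ≃* Q (Fin.cast hnm (σ i))) := by
  -- The triangularity lemma needs equality rather than isomorphism in its index type, so the counts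
  -- and the orders descend to isomorphism classes.
  let N : Quotient FiniteGrp.isoSetoid.{u} → Quotient FiniteGrp.isoSetoid.{u} → ℕ :=
    Quotient.lift₂ (fun A B => Nat.card (EssentialClass A B Unit))
      fun _ _ _ _ ⟨e⟩ ⟨f⟩ => EssentialClass.card_congr f e
  let size : Quotient FiniteGrp.isoSetoid.{u} → ℕ :=
    Quotient.lift (fun A => Nat.card A) fun _ _ ⟨e⟩ => Nat.card_congr e.toEquiv
  have key := Multiset.eq_of_sum_map_eq_of_triangular N size
    (by
      intro a
      induction a using Quotient.inductionOn with | h A => ?_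
      exact EssentialClass.card_self_ne_zero A)
    (by
      intro a b hab
      induction a using Quotient.inductionOn with | h A => ?_
      induction b using Quotient.inductionOn with | h B => ?_
      exact (EssentialClass.nonempty_mulEquiv_or_card_lt hab).imp Quotient.sound id)
    (Finset.univ.val.map fun i => Quotient.mk _ (P i))
    (Finset.univ.val.map fun j => Quotient.mk _ (Q j))
    (by
      intro a
      induction a using Quotient.inductionOn with | h A => ?_
      rw [Multiset.map_map, Multiset.map_map]
      exact h A)
  obtain rfl : n = m := by simpa using congrArg Multiset.card key
  obtain ⟨σ, hσ⟩ := exists_equiv_comp_eq_of_map_univ_eq _ _ key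
  exact ⟨rfl, σ, fun i => Quotient.exact (hσ i).symm⟩

/-! ### Essential points and weights of spans -/

namespace GSpan

variable {A B C : GFrac.{u}}

/-- A point `p` of a span from `X / G` to `Y / H` is essential if `G` acts freely on the orbit
`G p` and this orbit is contained in `H p`. -/
def IsEssential (U : GSpan A B) (p : U.pts) : Prop :=
  (∀ k : A.grp, ((1 : B.grp), k) • p = p → k = 1) ∧ ∀ k : A.grp, ∃ h : B.grp, (h, k) • p = p

/-- An element of `1 × A.grp` fixing `q` also fixes `[p, q]`, so freeness descends to `q`. If `(c,
k)` fixes `[p, q]`, the element of the middle group relating the two representatives supplies `b`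
with `(b, k) • q = q`. -/
theorem IsEssential.of_comp {V : GSpan B C} {U : GSpan A B} {p : V.pts} {q : U.pts}
    {h : V.right p = U.left q} (hpq : (comp V U).IsEssential (CompPts.mk p q h)) :
    U.IsEssential q := by
  refine ⟨fun k hk => hpq.1 k ?_, fun k => ?_⟩
  · refine (CompPts.smul_mk (1, k) p q h).trans (CompPts.mk_eq_iff.2 ⟨1, ?_, ?_⟩)
    · simp [← Prod.one_eq_mk]
    · rw [hk]; exact (one_smul _ q).symm
  · obtain ⟨c, hc⟩ := hpq.2 k
    obtain ⟨b, -, hb⟩ := CompPts.mk_eq_iff.1 ((CompPts.smul_mk (c, k) p q h).symm.trans hc)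
    exact ⟨b, by simpa [smul_smul] using hb.symm⟩

/-- Stabilizers along an orbit are conjugate, and both conditions are invariant under conjugation.
-/
theorem IsEssential.smul {U : GSpan A B} {p : U.pts} (hp : U.IsEssential p)
    (a : B.grp × A.grp) : U.IsEssential (a • p) := by
  refine ⟨fun k hk => ?_, fun k => ?_⟩
  · have e : ((1 : B.grp), a.2⁻¹ * k * a.2) = a⁻¹ * (1, k) * a := by
      ext <;> simp [mul_assoc]
    have h := hp.1 (a.2⁻¹ * k * a.2) (by rw [e, mul_smul, mul_smul, hk, inv_smul_smul])
    simpa [mul_assoc, inv_mul_eq_one] using h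
  · obtain ⟨h, hh⟩ := hp.2 (a.2⁻¹ * k * a.2)
    refine ⟨a.1 * h * a.1⁻¹, ?_⟩
    have e : (a.1 * h * a.1⁻¹, k) * a = a * (h, a.2⁻¹ * k * a.2) := by
      ext <;> simp [mul_assoc]
    rw [smul_smul, e, mul_smul, hh]

/-- The pair attached to an essential point: its image under the left leg, and its stabilizer. -/
def essentialPair (U : GSpan A B) (p : U.pts) (hp : U.IsEssential p) :
    EssentialPair A.grp B.grp B.pts where
  pt := U.left p
  sub := MulAction.stabilizer (B.grp × A.grp) p
  smul_eq := fun a ha => by rw [← U.left_smul a.1 a.2, show (a.1, a.2) • p = p from ha]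
  eq_one := hp.1
  exists_mem := hp.2

theorem essentialPair_smul (U : GSpan A B) (p : U.pts) (hp : U.IsEssential p)
    (a : B.grp × A.grp) : U.essentialPair p hp ≈ U.essentialPair (a • p) (hp.smul a) :=
  ⟨a, (U.left_smul a.1 a.2 p).symm, fun b => by
    change b • a • p = a • p ↔ (a⁻¹ * b * a) • p = p
    rw [mul_smul, mul_smul, inv_smul_eq_iff]⟩

variable {R : Type v} [AddCommMonoid R]

open scoped Classical in
/-- The value at the class of an essential point of a function on classes of essential pairs,
extended by zero to all points. -/
noncomputable def weight (f : EssentialClass A.grp B.grp B.pts → R) (U : GSpan A B)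
    (p : U.pts) : R :=
  if hp : U.IsEssential p then f (Quotient.mk _ (U.essentialPair p hp)) else 0

theorem weight_smul (f : EssentialClass A.grp B.grp B.pts → R) (U : GSpan A B)
    (a : B.grp × A.grp) (p : U.pts) : weight f U (a • p) = weight f U p := by
  unfold weight
  by_cases hp : U.IsEssential p
  · rw [dif_pos hp, dif_pos (hp.smul a), Quotient.sound (U.essentialPair_smul p hp a)]
  · rw [dif_neg hp, dif_neg fun h => hp (by simpa using h.smul a⁻¹)]

/-- An injective equivariant map preserves stabilizers, and the essential pair only records the
stabilizer and the left leg. This covers both isomorphisms and inclusions of summands. -/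
theorem weight_map (f : EssentialClass A.grp B.grp B.pts → R) {U W : GSpan A B}
    (j : U.pts → W.pts) (hj : Function.Injective j) (hs : ∀ (a : B.grp × A.grp) p, j (a • p) = a • j p)
    (hl : ∀ p, W.left (j p) = U.left p) (p : U.pts) : weight f W (j p) = weight f U p := by
  have hst : ∀ a : B.grp × A.grp, a • j p = j p ↔ a • p = p := fun a => by
    rw [← hs, hj.eq_iff]
  have hess : W.IsEssential (j p) ↔ U.IsEssential p := by
    simp only [IsEssential, hst]
  unfold weight
  by_cases hp : U.IsEssential p
  · rw [dif_pos hp, dif_pos (hess.2 hp)]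
    exact congrArg (fun e => f (Quotient.mk _ e))
      (EssentialPair.ext (hl p) (Subgroup.ext fun a => hst a))
  · rw [dif_neg hp, dif_neg (hess.not.2 hp)]

/-- The orbits of a span. -/
abbrev Orbits (U : GSpan A B) : Type u := MulAction.orbitRel.Quotient (B.grp × A.grp) U.pts

/-- The map on orbits induced by an equivariant map. -/
def orbitsMap {U W : GSpan A B} (j : U.pts → W.pts) (hs : ∀ (a : B.grp × A.grp) p, j (a • p) = a • j p) :
    U.Orbits → W.Orbits :=
  Quotient.map' j (by
    rintro _ q ⟨a, rfl⟩
    exact ⟨a, (hs a q).symm⟩)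

theorem orbitsMap_eq_orbitsMap {U U' W : GSpan A B} {j : U.pts → W.pts}
    {hs : ∀ (a : B.grp × A.grp) p, j (a • p) = a • j p} {j' : U'.pts → W.pts}
    {hs' : ∀ (a : B.grp × A.grp) p, j' (a • p) = a • j' p} {x : U.Orbits} {y : U'.Orbits}
    (h : orbitsMap j hs x = orbitsMap j' hs' y) :
    ∃ p q, j p = j' q ∧ Quotient.mk'' p = x ∧ Quotient.mk'' q = y := by
  induction x using Quotient.inductionOn' with | h p => ?_
  induction y using Quotient.inductionOn' with | h q => ?_
  obtain ⟨a, ha⟩ := Quotient.exact h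
  exact ⟨p, a • q, ha.symm.trans (hs' a q).symm, rfl, Quotient.sound ⟨a, rfl⟩⟩

theorem orbitsMap_injective {U W : GSpan A B} {j : U.pts → W.pts}
    {hs : ∀ (a : B.grp × A.grp) p, j (a • p) = a • j p} (hj : Function.Injective j) :
    Function.Injective (orbitsMap j hs) := by
  intro x y h
  obtain ⟨p, q, e, rfl, rfl⟩ := orbitsMap_eq_orbitsMap h
  rw [hj e]

/-- The weight of an orbit. -/
noncomputable def orbitWeight (f : EssentialClass A.grp B.grp B.pts → R) (U : GSpan A B) :
    U.Orbits → R :=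
  Quotient.lift (weight f U) (by
    rintro _ q ⟨a, rfl⟩
    exact weight_smul f U a q)

theorem orbitWeight_orbitsMap (f : EssentialClass A.grp B.grp B.pts → R) {U W : GSpan A B}
    (j : U.pts → W.pts) (hj : Function.Injective j) (hs : ∀ (a : B.grp × A.grp) p, j (a • p) = a • j p)
    (hl : ∀ p, W.left (j p) = U.left p) (x : U.Orbits) :
    orbitWeight f W (orbitsMap j hs x) = orbitWeight f U x := by
  induction x using Quotient.inductionOn' with | h p => ?_
  exact weight_map f j hj hs hl p

/-- The sum of the weights of the orbits of a span. -/
noncomputable def totalWeight (f : EssentialClass A.grp B.grp B.pts → R) (U : GSpan A B) : R :=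
  ∑ᶠ x : U.Orbits, orbitWeight f U x

theorem totalWeight_congr (f : EssentialClass A.grp B.grp B.pts → R) {U W : GSpan A B}
    (h : Iso U W) : totalWeight f U = totalWeight f W := by
  obtain ⟨e, hs, hl, -⟩ := h
  refine finsum_eq_of_bijective (orbitsMap e hs) ⟨orbitsMap_injective e.injective, fun y => ?_⟩
    fun x => (orbitWeight_orbitsMap f e e.injective hs hl x).symm
  induction y using Quotient.inductionOn' with | h q => ?_
  exact ⟨Quotient.mk'' (e.symm q), congrArg _ (e.apply_symm_apply q)⟩

theorem totalWeight_of_isEmpty (f : EssentialClass A.grp B.grp B.pts → R) (U : GSpan A B)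
    [IsEmpty U.pts] : totalWeight f U = 0 := by
  have : IsEmpty U.Orbits := ⟨fun x => Quotient.inductionOn' x isEmptyElim⟩
  exact finsum_of_isEmpty _

/-- The orbits of a disjoint union are those of the two summands, with the same weights; hence the
weight extends to the Grothendieck group. -/
theorem totalWeight_sum (f : EssentialClass A.grp B.grp B.pts → R) (U W : GSpan A B) :
    totalWeight f (sum U W) = totalWeight f U + totalWeight f W := by
  have hl : ∀ (a : B.grp × A.grp) p, (Sum.inl (a • p) : (sum U W).pts) = a • (Sum.inl p : (sum U W).pts) :=
    fun _ _ => rfl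
  have hr : ∀ (a : B.grp × A.grp) p, (Sum.inr (a • p) : (sum U W).pts) = a • (Sum.inr p : (sum U W).pts) :=
    fun _ _ => rfl
  let F : U.Orbits ⊕ W.Orbits → (sum U W).Orbits := Sum.elim
    (orbitsMap (W := sum U W) Sum.inl hl) (orbitsMap (W := sum U W) Sum.inr hr)
  have hF : Function.Bijective F := by
    constructor
    · refine Function.Injective.sumElim (orbitsMap_injective Sum.inl_injective)
        (orbitsMap_injective Sum.inr_injective) fun x y h => ?_
      obtain ⟨p, q, e, -⟩ := orbitsMap_eq_orbitsMap h
      cases e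
    · intro y
      induction y using Quotient.inductionOn' with | h q => ?_
      rcases q with q | q
      · exact ⟨Sum.inl (Quotient.mk'' q), rfl⟩
      · exact ⟨Sum.inr (Quotient.mk'' q), rfl⟩
  have : Fintype U.Orbits := Fintype.ofFinite _
  have : Fintype W.Orbits := Fintype.ofFinite _
  unfold totalWeight
  rw [← finsum_eq_of_bijective (f := fun x => orbitWeight f (sum U W) (F x)) F hF fun _ => rfl,
    finsum_eq_sum_of_fintype, finsum_eq_sum_of_fintype, finsum_eq_sum_of_fintype,
    Fintype.sum_sum_type]
  exact congrArg₂ _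
    (Finset.sum_congr rfl fun x _ => orbitWeight_orbitsMap f (W := sum U W) Sum.inl
      Sum.inl_injective hl (fun _ => rfl) x)
    (Finset.sum_congr rfl fun x _ => orbitWeight_orbitsMap f (W := sum U W) Sum.inr
      Sum.inr_injective hr (fun _ => rfl) x)

theorem totalWeight_of_transitive (f : EssentialClass A.grp B.grp B.pts → R) (U : GSpan A B)
    (p : U.pts) (hp : ∀ q, ∃ a : B.grp × A.grp, a • p = q) :
    totalWeight f U = weight f U p := by
  have : Unique U.Orbits :=
    { default := Quotient.mk'' p
      uniq := fun x => Quotient.inductionOn' x fun q => Quotient.sound (hp q) }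
  exact (finsum_unique (orbitWeight f U)).trans
    (congrArg (orbitWeight f U) (Subsingleton.elim _ (Quotient.mk'' p)))

theorem totalWeight_add (f g : EssentialClass A.grp B.grp B.pts → R) (U : GSpan A B) :
    totalWeight (f + g) U = totalWeight f U + totalWeight g U := by
  unfold totalWeight
  rw [← finsum_add_distrib (Set.toFinite _) (Set.toFinite _)]
  refine finsum_congr fun x => Quotient.inductionOn' x fun p => ?_
  change weight (f + g) U p = weight f U p + weight g U p
  unfold weight
  split_ifs
  · rfl
  · rw [add_zero]

theorem totalWeight_smul {R : Type v} [CommRing R] (r : R)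
    (f : EssentialClass A.grp B.grp B.pts → R) (U : GSpan A B) :
    totalWeight (r • f) U = r * totalWeight f U := by
  unfold totalWeight
  rw [← smul_eq_mul, smul_finsum' _ (Set.toFinite _)]
  refine finsum_congr fun x => Quotient.inductionOn' x fun p => ?_
  change weight (r • f) U p = r • weight f U p
  unfold weight
  split_ifs
  · rfl
  · rw [smul_zero]

theorem totalWeight_eq_zero (f : EssentialClass A.grp B.grp B.pts → R) (U : GSpan A B)
    (h : ∀ p, ¬ U.IsEssential p) : totalWeight f U = 0 :=
  finsum_eq_zero_of_forall_eq_zero fun x => Quotient.inductionOn' x fun p => dif_neg (h p)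

/-- The restriction of a span to an invariant subset. -/
def restrict (U : GSpan A B) (S : Set U.pts) (hS : ∀ (a : B.grp × A.grp), ∀ p ∈ S, a • p ∈ S) :
    GSpan A B where
  pts := S
  action :=
    { smul := fun a p => ⟨a • p.1, hS a p.1 p.2⟩
      one_smul := fun p => Subtype.ext (one_smul _ p.1)
      mul_smul := fun a b p => Subtype.ext (mul_smul a b p.1) }
  left := fun p => U.left p.1
  right := fun p => U.right p.1
  left_smul := fun h g p => U.left_smul h g p.1
  right_smul := fun h g p => U.right_smul h g p.1

theorem smul_mem_compl (U : GSpan A B) {S : Set U.pts}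
    (hS : ∀ (a : B.grp × A.grp), ∀ p ∈ S, a • p ∈ S) (a : B.grp × A.grp) :
    ∀ p ∈ Sᶜ, a • p ∈ Sᶜ :=
  fun p hp h => hp (by simpa using hS a⁻¹ _ h)

theorem sum_restrict_compl (U : GSpan A B) (S : Set U.pts)
    (hS : ∀ (a : B.grp × A.grp), ∀ p ∈ S, a • p ∈ S) :
    Iso (sum (U.restrict S hS) (U.restrict Sᶜ (U.smul_mem_compl hS))) U := by
  classical
  refine ⟨Equiv.Set.sumCompl S, ?_, ?_, ?_⟩
  · rintro a (p | p) <;> rfl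
  · rintro (p | p) <;> rfl
  · rintro (p | p) <;> rfl

end GSpan

/-! ### Reduction to transitive spans -/

namespace SpanClass

variable {A B : GFrac.{u}}

/-- The total weight as an additive map on isomorphism classes of spans. -/
noncomputable def totalWeight {R : Type v} [AddCommMonoid R]
    (f : EssentialClass A.grp B.grp B.pts → R) : SpanClass A B →+ R where
  toFun := Quotient.lift (GSpan.totalWeight f) fun _ _ => GSpan.totalWeight_congr f
  map_zero' := by
    have : IsEmpty (GSpan.empty A B).pts := inferInstanceAs (IsEmpty PEmpty)
    exact GSpan.totalWeight_of_isEmpty f _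
  map_add' := ind fun U => ind fun W => GSpan.totalWeight_sum f U W

/-- An additive map vanishes if it vanishes at transitive spans. -/
theorem eq_zero_of_transitive {M : Type*} [AddCommMonoid M] (ψ : SpanClass A B →+ M)
    (h : ∀ (U : GSpan A B) (p : U.pts), (∀ q, ∃ a : B.grp × A.grp, a • p = q) → ψ (mk U) = 0)
    (U : GSpan A B) : ψ (mk U) = 0 := by
  induction hn : Nat.card U.pts using Nat.strong_induction_on generalizing U with | _ n ih => ?_
  rcases isEmpty_or_nonempty U.pts with hU | ⟨⟨p⟩⟩
  · have e : GSpan.Iso U (GSpan.empty A B) :=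
      ⟨(Equiv.equivPEmpty U.pts), fun _ p => isEmptyElim p, fun p => isEmptyElim p,
        fun p => isEmptyElim p⟩
    rw [sound e]
    exact map_zero ψ
  -- Split off the orbit of `p`; its complement has fewer points.
  · let S := MulAction.orbit (B.grp × A.grp) p
    have hS : ∀ (a : B.grp × A.grp), ∀ q ∈ S, a • q ∈ S := fun a q hq =>
      MulAction.mem_orbit_of_mem_orbit a hq
    rw [← sound (U.sum_restrict_compl S hS)]
    refine (map_add ψ (mk _) (mk _)).trans ?_
    rw [h (U.restrict S hS) ⟨p, MulAction.mem_orbit_self p⟩, zero_add]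
    · refine ih _ ?_ _ rfl
      rw [← hn]
      exact Finite.card_subtype_lt (p := (· ∈ Sᶜ)) (x := p)
        (not_not_intro (MulAction.mem_orbit_self p))
    · rintro ⟨_, a, rfl⟩
      exact ⟨a, rfl⟩

end SpanClass

namespace EssentialPair

variable {A B : GFrac.{u}} [Unique A.pts]

/-- The transitive span attached to an essential pair `(x, L)`: the cosets of `L`, with left leg
`a L ↦ a x`. -/
def toSpan (e : EssentialPair A.grp B.grp B.pts) : GSpan A B where
  pts := (B.grp × A.grp) ⧸ e.sub
  left := Quotient.lift (fun a => a.1 • e.pt) (by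
    intro a b hab
    have := e.smul_eq _ (QuotientGroup.leftRel_apply.1 hab)
    rw [Prod.fst_mul, Prod.fst_inv, mul_smul, inv_smul_eq_iff] at this
    exact this.symm)
  right := fun _ => default
  left_smul := fun h g p => Quotient.inductionOn p fun a => mul_smul h a.1 e.pt
  right_smul := fun _ _ _ => Subsingleton.elim _ _

/-- This is the orbit-stabilizer bijection. The right legs agree because `A.pts` is a single point.
-/
theorem toSpan_iso (e : EssentialPair A.grp B.grp B.pts) (U : GSpan A B) (p : U.pts)
    (hp : ∀ q, ∃ a : B.grp × A.grp, a • p = q) (hpt : U.left p = e.pt)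
    (hsub : ∀ a : B.grp × A.grp, a ∈ e.sub ↔ a • p = p) : GSpan.Iso e.toSpan U := by
  let F : e.toSpan.pts → U.pts := Quotient.lift (fun a : B.grp × A.grp => a • p) (by
    intro a b hab
    have := (hsub _).1 (QuotientGroup.leftRel_apply.1 hab)
    rw [mul_smul, inv_smul_eq_iff] at this
    exact this.symm)
  refine ⟨Equiv.ofBijective F ⟨?_, fun q => ?_⟩, ?_, ?_, fun _ => Subsingleton.elim _ _⟩
  · intro x y
    induction x using Quotient.inductionOn with | h a => ?_
    induction y using Quotient.inductionOn with | h b => ?_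
    intro (hab : a • p = b • p)
    refine Quotient.sound (QuotientGroup.leftRel_apply.2 ((hsub _).2 ?_))
    rw [mul_smul, ← hab, inv_smul_smul]
  · obtain ⟨a, ha⟩ := hp q
    exact ⟨Quotient.mk _ a, ha⟩
  · exact fun a x => Quotient.inductionOn x fun b => mul_smul a b p
  · exact fun x => Quotient.inductionOn x fun b =>
      (U.left_smul b.1 b.2 p).trans (congrArg (b.1 • ·) hpt)

/-- This is the duality between weights and standard spans: evaluation on them recovers `f`. The
coset of `1` has stabilizer `e.sub` and left leg `e.pt`. -/
theorem totalWeight_toSpan {R : Type v} [AddCommMonoid R] (f : EssentialClass A.grp B.grp B.pts → R)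
    (e : EssentialPair A.grp B.grp B.pts) :
    GSpan.totalWeight f e.toSpan = f (Quotient.mk _ e) := by
  let p : e.toSpan.pts := ((1 : B.grp × A.grp) : (B.grp × A.grp) ⧸ e.sub)
  have hst : ∀ a : B.grp × A.grp, a • p = p ↔ a ∈ e.sub := fun a => by
    change ((a * 1 : B.grp × A.grp) : (B.grp × A.grp) ⧸ e.sub) = ((1 : B.grp × A.grp) : (B.grp × A.grp) ⧸ e.sub) ↔ _
    rw [QuotientGroup.eq]
    simp
  have hess : e.toSpan.IsEssential p :=
    ⟨fun k hk => e.eq_one k ((hst _).1 hk), fun k =>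
      (e.exists_mem k).imp fun h hk => (hst _).2 hk⟩
  rw [GSpan.totalWeight_of_transitive f _ p, GSpan.weight, dif_pos hess]
  · exact congrArg (fun e => f (Quotient.mk _ e))
      (EssentialPair.ext (one_smul _ e.pt) (Subgroup.ext fun a => hst a))
  · exact fun q => Quotient.inductionOn q fun a => ⟨a, congrArg _ (mul_one a)⟩

end EssentialPair

/-! ### Linear forms and comparison of ranks -/

namespace RBurnside

variable {R : Type v} [CommRing R] {A B C : GFrac.{u}}

/-- The class of a span in `RB^{H, G}(Y, X)`. -/
noncomputable def mk (R : Type v) [CommRing R] (U : GSpan A B) : RBurnside R A B :=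
  1 ⊗ₜ SpanBurnside.mk U

theorem comp_mk (V : GSpan B C) (U : GSpan A B) :
    comp R A B C (mk R V) (mk R U) = mk R (V.comp U) := by
  rw [mk, mk, comp_tmul, one_mul, SpanBurnside.comp_mk, mk]

theorem hom_ext {M : Type*} [AddCommGroup M] [Module R M] {φ ψ : RBurnside R A B →ₗ[R] M}
    (h : ∀ U, φ (mk R U) = ψ (mk R U)) : φ = ψ := by
  refine TensorProduct.AlgebraTensorModule.curry_injective (LinearMap.ext_ring ?_)
  have := SpanBurnside.hom_ext
    (f := (TensorProduct.AlgebraTensorModule.curry φ 1).toAddMonoidHom)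
    (g := (TensorProduct.AlgebraTensorModule.curry ψ 1).toAddMonoidHom) h
  exact LinearMap.ext fun x => DFunLike.congr_fun this x

/-- The linear form on `RB^{H, G}(Y, X)` given by the total weight of spans. -/
noncomputable def weightForm (A B : GFrac.{u}) (R : Type v) [CommRing R] :
    (EssentialClass A.grp B.grp B.pts → R) →ₗ[R] RBurnside R A B →ₗ[R] R :=
  have key : ∀ (f : EssentialClass A.grp B.grp B.pts → R) (U : GSpan A B),
      LinearMap.liftBaseChange R (SpanBurnside.lift (SpanClass.totalWeight f)).toIntLinearMap
        (mk R U) = GSpan.totalWeight f U := fun f U => by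
    rw [mk, LinearMap.liftBaseChange_tmul, one_smul]
    exact SpanBurnside.lift_mk _ U
  { toFun := fun f => LinearMap.liftBaseChange R
      (SpanBurnside.lift (SpanClass.totalWeight f)).toIntLinearMap
    map_add' := fun f g => hom_ext fun U => by
      rw [LinearMap.add_apply, key, key, key, GSpan.totalWeight_add]
    map_smul' := fun r f => hom_ext fun U => by
      rw [LinearMap.smul_apply, key, key, GSpan.totalWeight_smul]
      rfl }

theorem weightForm_mk (f : EssentialClass A.grp B.grp B.pts → R) (U : GSpan A B) :
    weightForm A B R f (mk R U) = GSpan.totalWeight f U := by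
  change LinearMap.liftBaseChange R
    (SpanBurnside.lift (SpanClass.totalWeight f)).toIntLinearMap (mk R U) = _
  rw [mk, LinearMap.liftBaseChange_tmul, one_smul]
  exact SpanBurnside.lift_mk _ U

/-- Post-composition preserves the spans without essential points, up to linear combinations. -/
theorem weightForm_comp_mk_eq_zero (f : EssentialClass A.grp C.grp C.pts → R)
    (x : RBurnside R B C) (U : GSpan A B) (h : ∀ p, ¬ U.IsEssential p) :
    weightForm A C R f (comp R A B C x (mk R U)) = 0 := by
  have : (weightForm A C R f).comp ((comp R A B C).flip (mk R U)) = 0 := hom_ext fun V => by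
    rw [LinearMap.comp_apply, LinearMap.flip_apply, comp_mk, weightForm_mk, LinearMap.zero_apply]
    exact GSpan.totalWeight_eq_zero f _ (GSpan.CompPts.ind fun p q hpq hc => h q hc.of_comp)
  exact LinearMap.congr_fun this x

/-- A linear form which vanishes at spans without essential points is determined by its values at
the transitive spans attached to essential pairs. -/
theorem eq_zero_of_toSpan [Unique A.pts]
    (φ : RBurnside R A B →ₗ[R] R)
    (h : ∀ U, (∀ p, ¬ U.IsEssential p) → φ (mk R U) = 0)
    (h' : ∀ c : EssentialClass A.grp B.grp B.pts, φ (mk R (Quotient.out c).toSpan) = 0) : φ = 0 := by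
  let ψ : SpanClass A B →+ R :=
    ((TensorProduct.AlgebraTensorModule.curry φ 1).toAddMonoidHom).comp
      Algebra.GrothendieckAddGroup.of
  refine hom_ext fun U => SpanClass.eq_zero_of_transitive ψ (fun U p hp => ?_) U
  by_cases hess : U.IsEssential p
  · let c : EssentialClass A.grp B.grp B.pts := Quotient.mk _ (U.essentialPair p hess)
    -- The chosen representative is only conjugate to the pair of `p`; replacing `p` by its
    -- translate `a • p` makes point and stabilizer match exactly.
    obtain ⟨a, h1, h2⟩ := Quotient.exact (s := EssentialPair.setoid _ _ _)
      (Quotient.out_eq c).symm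
    have e : GSpan.Iso (Quotient.out c).toSpan U := by
      refine EssentialPair.toSpan_iso _ U (a • p) (fun q => ?_) ?_ fun b => ?_
      · obtain ⟨b, hb⟩ := hp q
        exact ⟨b * a⁻¹, by rw [mul_smul, inv_smul_smul, hb]⟩
      · exact (U.left_smul a.1 a.2 p).trans h1
      · rw [h2]
        change (a⁻¹ * b * a) • p = p ↔ b • a • p = a • p
        rw [mul_smul, mul_smul, inv_smul_eq_iff]
    rw [← SpanClass.sound e]
    exact h' _
  -- In a transitive span, one essential point would make all of them essential.
  · refine h U fun q hq => hess ?_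
    obtain ⟨a, rfl⟩ := hp q
    simpa using hq.smul a⁻¹

/-- A morphism with a right inverse cannot increase the number of essential classes. -/
theorem card_essentialClass_le [Nontrivial R] (A : GFrac.{u}) [Unique A.pts]
    (x : RBurnside R B C) (y : RBurnside R C B) (hxy : comp R C B C x y = one R C) :
    Nat.card (EssentialClass A.grp C.grp C.pts) ≤ Nat.card (EssentialClass A.grp B.grp B.pts) := by
  have : Fintype (EssentialClass A.grp C.grp C.pts) := Fintype.ofFinite _
  have : Fintype (EssentialClass A.grp B.grp B.pts) := Fintype.ofFinite _
  -- `F` is the transpose of post-composition with `x`, written in terms of the standard spans over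
  -- `B`.
  let F : (EssentialClass A.grp C.grp C.pts → R) →ₗ[R] (EssentialClass A.grp B.grp B.pts → R) :=
    LinearMap.pi fun c => (LinearMap.applyₗ
      (comp R A B C x (mk R (Quotient.out c).toSpan))).comp
        (weightForm A C R)
  have hF : Function.Injective F := by
    rw [injective_iff_map_eq_zero]
    intro f hf
    have h0 : (weightForm A C R f).comp (comp R A B C x) = 0 :=
      eq_zero_of_toSpan _ (fun U hU => weightForm_comp_mk_eq_zero f x U hU)
        fun c => congrFun hf c
    funext c
    -- Evaluating the zero form at `y ∘ toSpan` cancels `x ∘ y` and leaves the value `f c`.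
    have h1 := LinearMap.congr_fun h0
      (comp R A C B y (mk R (Quotient.out c).toSpan))
    rw [LinearMap.comp_apply, ← comp_assoc, hxy, one_comp, weightForm_mk,
      EssentialPair.totalWeight_toSpan] at h1
    exact (congrArg f (Quotient.out_eq c)).symm.trans h1
  rw [Nat.card_eq_fintype_card, Nat.card_eq_fintype_card]
  -- Over a nontrivial commutative ring, an injection of finite free modules cannot lower the rank.
  exact card_le_of_injective R F hF

end RBurnside

/-! ### The main theorem -/

/-- The fraction `• / K`. -/
abbrev GFrac.point (K : Type u) [Group K] [Finite K] : GFrac.{u} where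
  grp := K
  pts := PUnit

theorem mainTheorem4 (R : Type v) [CommRing R] [Nontrivial R]
    (G H : Type u) [Group G] [Finite G] [Group H] [Finite H]
    (X Y : Type u) [MulAction G X] [Finite X] [MulAction H Y] [Finite Y]
    {n m : ℕ}
    (O : Fin n → Set X) (S : Fin n → Subgroup G) (hX : IsOrbitDecomposition O S)
    (T : Fin m → Set Y) (S' : Fin m → Subgroup H) (hY : IsOrbitDecomposition T S')
    (h : Nonempty (FracCat.of R G X ≅ FracCat.of R H Y)) :
    ∃ hnm : n = m, ∃ σ : Equiv.Perm (Fin n),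
      ∀ i, Nonempty (S i ≃* S' (Fin.cast hnm (σ i))) := by
  obtain ⟨e⟩ := h
  refine exists_perm_mulEquiv_of_card_essentialClass_eq (fun i => FiniteGrp.of (S i))
    (fun j => FiniteGrp.of (S' j)) fun K => ?_
  refine (EssentialClass.card_eq_sum hX).symm.trans
    (Eq.trans ?_ (EssentialClass.card_eq_sum hY))
  -- Each of `e.hom` and `e.inv` has the other as a right inverse, which gives the two inequalities.
  exact le_antisymm
    (RBurnside.card_essentialClass_le (B := (FracCat.of R H Y).frac) (C := (FracCat.of R G X).frac)
      (GFrac.point K) e.inv e.hom e.hom_inv_id)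
    (RBurnside.card_essentialClass_le (B := (FracCat.of R G X).frac) (C := (FracCat.of R H Y).frac)
      (GFrac.point K) e.hom e.inv e.inv_hom_id)
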